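/- Let $\alpha_1>0$ and $\alpha_2\ge 1$. For a bounded open interval $\Omega\subset\mathbb R$, consider the obstacle-type quasi-variational inequality (QVI) $$\text{find } u\in H_0^1(\Omega):\quad u\le \Phi_0+\Phi(u)\ \text{a.e. in }\Omega,\qquad \langle -u''-f,\,v-u\rangle_{H^{-1}(\Omega),H_0^1(\Omega)}\ge 0\quad \forall v\in H_0^1(\Omega),\ v\le\Phi_0+\Phi(u)\ \text{a.e. in }\Omega,$$ where $\Phi(u):=\varphi T$ and $T\in H^1(\Omega)$ is the (unique) weak solution of $kT-T''=g(\Psi_0+\psi T-u)$ in $\Omega$ with $\partial_\nu T=0$ on $\partial\Omega$. Choose the data $$\Omega=(0,1),\quad \Phi_0\equiv 0,\quad f(x)=\alpha_1\pi^2\sin(\pi x),\quad \varphi(x)=\alpha_2\frac{10\pi^2\sin(\pi x)}{5-\cos(2\pi x)},\quad k=\pi^2,$$ $$g(s)=\frac{4}{\alpha_1}\min(0,s)^2,\quad \Psi_0\equiv 0,\quad \psi(x)=\frac{5\pi^2\sin(\pi x)}{5-\cos(2\pi x)}.$$ Then the QVI has (at least) the two distinct solutions $\bar u_1\equiv 0$,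 with temperature $\bar T_1\equiv 0$, and $\bar u_2(x)=\alpha_1\sin(\pi x)$, with temperature $\bar T_2(x)=\alpha_1\frac{5-\cos(2\pi x)}{10\pi^2}$. For $a<b$ let $\mathrm{Lip}(g,[a,b])$ denote the smallest Lipschitz constant of $g$ on $[a,b]$, and for $R>0$ define $N_R:=|\Omega|^{1/2}R/2$ and $$M_R:=N_R+\|\psi\|_{L^\infty(\Omega)}\left(|\Omega|^{-1/2}k^{-1}+|\Omega|^{1/2}k^{-1/2}\right)\left(\mathrm{Lip}(g,[-N_R,N_R])\frac{2N_R}{\pi}+|g(0)|\right)|\Omega|^{1/2}.$$ Then for every $R>0$ $$M_R=\frac12R+\frac{10(1+\pi)}{3\pi\alpha_1}R^2$$ and $$\begin{aligned}&\mathrm{Lip}(g,[-M_R,M_R])\left(\|\varphi\|_{L^\infty(\Omega)}k^{-1/2}+\|\varphi'\|_{L^\infty(\Omega)}k^{-1}\right)\frac{|\Omega|}{\pi}\\&\quad=\lim_{t\searrow M_R}\mathrm{Lip}(g,[-t,t])\left(\|\varphi\|_{L^\infty(\Omega)}k^{-1/2}+\|\varphi'\|_{L^\infty(\Omega)}k^{-1}\right)\frac{|\Omega|}{\pi}=\frac{50\alpha_2}{3\alpha_1}\left(R+\frac{20(1+\pi)}{3\pi\alpha_1}R^2\right).\end{aligned}$$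 Furthermore, for $R>0$, the right-hand side of the last identity lies in $[0,1)$ if and only if $$R<R_{\alpha_1,\alpha_2}:=\frac{3\alpha_1}{10(1+\pi)}\left(\sqrt{\frac{(5\alpha_2+8)\pi^2+8\pi}{80\alpha_2}}-\frac{\pi}{4}\right).$$ -/

import Mathlib

open Real Set Filter Topology MeasureTheory
open scoped ContDiff ENNReal

noncomputable section

namespace ThermoQVI

/-- `C_c^∞(Ω)`, realised as the smooth functions on `ℝ` with compact support contained in `Ω`. -/
def IsTestFunction (Ω : Set ℝ) (η : ℝ → ℝ) : Prop :=
  ContDiff ℝ ∞ η ∧ HasCompactSupport η ∧ tsupport η ⊆ Ω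

/-- `u'` is a weak derivative of `u` on `Ω`. -/
def IsWeakDeriv (Ω : Set ℝ) (u u' : ℝ → ℝ) : Prop :=
  ∀ η : ℝ → ℝ, IsTestFunction Ω η →
    ∫ x in Ω, u x * deriv η x = - ∫ x in Ω, u' x * η x

/-- `u ∈ H¹(Ω)` with weak derivative `u'`. Functions are regarded up to equality almost everywhere
on `Ω`. -/
def MemH1 (Ω : Set ℝ) (u u' : ℝ → ℝ) : Prop :=
  MemLp u 2 (volume.restrict Ω) ∧ MemLp u' 2 (volume.restrict Ω) ∧ IsWeakDeriv Ω u u'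

/-- `u ∈ H₀¹(Ω)` with weak derivative `u'`: `u` belongs to the closure of `C_c^∞(Ω)` in `H¹(Ω)`. -/
def MemH10 (Ω : Set ℝ) (u u' : ℝ → ℝ) : Prop :=
  MemH1 Ω u u' ∧ ∃ η : ℕ → ℝ → ℝ, (∀ n, IsTestFunction Ω (η n)) ∧
    Tendsto (fun n => eLpNorm (fun x => u x - η n x) 2 (volume.restrict Ω)) atTop (𝓝 0) ∧
    Tendsto (fun n => eLpNorm (fun x => u' x - deriv (η n) x) 2 (volume.restrict Ω)) atTop (𝓝 0)

/-- The data of the one-dimensional obstacle-type quasi-variational inequality. Functions on `Ω`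
are given by functions on `ℝ` of which only the values on `Ω` matter. -/
structure Data where
  /-- the domain -/
  Ω : Set ℝ
  /-- the fixed part of the obstacle -/
  Φ₀ : ℝ → ℝ
  /-- the external force -/
  f : ℝ → ℝ
  /-- the factor in `Φ(u) = φ T` -/
  φ : ℝ → ℝ
  /-- the zeroth-order coefficient of the temperature equation -/
  k : ℝ
  /-- the nonlinearity of the temperature equation -/
  g : ℝ → ℝ
  /-- the fixed part of the argument of the nonlinearity -/
  Ψ₀ : ℝ → ℝ
  /-- the factor of the temperature in the argument of the nonlinearity -/
  ψ : ℝ → ℝ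

/-- `T ∈ H¹(Ω)` is a weak solution of
`k T - T'' = g(Ψ₀ + ψ T - u)` in `Ω`, `∂_ν T = 0` on `∂Ω`. -/
def Data.IsTemperature (D : Data) (u T : ℝ → ℝ) : Prop :=
  MemLp (fun x => D.g (D.Ψ₀ x + D.ψ x * T x - u x)) 2 (volume.restrict D.Ω) ∧
  ∃ T' : ℝ → ℝ, MemH1 D.Ω T T' ∧
    ∀ ζ ζ' : ℝ → ℝ, MemH1 D.Ω ζ ζ' →
      ∫ x in D.Ω, (D.k * T x * ζ x + T' x * ζ' x) =
        ∫ x in D.Ω, D.g (D.Ψ₀ x + D.ψ x * T x - u x) * ζ x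

/-- `T` is the (up to null sets unique) weak solution of the temperature equation for `u`, so that
`Φ(u) = φ T`. -/
def Data.IsTheTemperature (D : Data) (u T : ℝ → ℝ) : Prop :=
  D.IsTemperature u T ∧
    ∀ S : ℝ → ℝ, D.IsTemperature u S → S =ᵐ[volume.restrict D.Ω] T

/-- `(u, T)` solves the quasi-variational inequality: `T` is the temperature belonging to `u`,
`u ∈ H₀¹(Ω)`, `u ≤ Φ₀ + Φ(u)` and `⟨-u'' - f, v - u⟩ ≥ 0` for all `v ∈ H₀¹(Ω)` with
`v ≤ Φ₀ + Φ(u)`, where `Φ(u) = φ T`. -/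
def Data.IsSolution (D : Data) (u T : ℝ → ℝ) : Prop :=
  D.IsTheTemperature u T ∧
  ∃ u' : ℝ → ℝ, MemH10 D.Ω u u' ∧
    (∀ᵐ x ∂(volume.restrict D.Ω), u x ≤ D.Φ₀ x + D.φ x * T x) ∧
    ∀ v v' : ℝ → ℝ, MemH10 D.Ω v v' →
      (∀ᵐ x ∂(volume.restrict D.Ω), v x ≤ D.Φ₀ x + D.φ x * T x) →
      0 ≤ (∫ x in D.Ω, u' x * (v' x - u' x)) - ∫ x in D.Ω, D.f x * (v x - u x)

/-- The Lipschitz constant of `g` on `[a, b]`, i.e. the smallest `c ≥ 0` with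
`|g s - g t| ≤ c |s - t|` for all `s, t ∈ [a, b]`. -/
def lipConst (g : ℝ → ℝ) (a b : ℝ) : ℝ :=
  sInf {c : ℝ | 0 ≤ c ∧ ∀ s ∈ Icc a b, ∀ t ∈ Icc a b, |g s - g t| ≤ c * |s - t|}

/-- The norm of `L^∞(Ω)`. -/
def supNorm (Ω : Set ℝ) (h : ℝ → ℝ) : ℝ :=
  (eLpNorm h ∞ (volume.restrict Ω)).toReal

/-- `N_R = |Ω|^{1/2} R / 2`. -/
def Data.N (D : Data) (R : ℝ) : ℝ :=
  volume.real D.Ω ^ (1 / 2 : ℝ) * R / 2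

/-- `M_R = N_R + ‖ψ‖_∞ (|Ω|^{-1/2} k⁻¹ + |Ω|^{1/2} k^{-1/2})
  (Lip(g, [-N_R, N_R]) 2 N_R / π + |g(0)|) |Ω|^{1/2}`. -/
def Data.M (D : Data) (R : ℝ) : ℝ :=
  D.N R + supNorm D.Ω D.ψ *
    (volume.real D.Ω ^ (-(1 / 2) : ℝ) * D.k⁻¹ +
      volume.real D.Ω ^ (1 / 2 : ℝ) * D.k ^ (-(1 / 2) : ℝ)) *
    (lipConst D.g (-D.N R) (D.N R) * (2 * D.N R / π) + |D.g 0|) *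
    volume.real D.Ω ^ (1 / 2 : ℝ)

/-- `Lip(g, [-t, t]) (‖φ‖_∞ k^{-1/2} + ‖φ'‖_∞ k⁻¹) |Ω| / π`. -/
def Data.contractionFactor (D : Data) (t : ℝ) : ℝ :=
  lipConst D.g (-t) t *
    (supNorm D.Ω D.φ * D.k ^ (-(1 / 2) : ℝ) + supNorm D.Ω (deriv D.φ) * D.k⁻¹) *
    (volume.real D.Ω / π)

/-- The data of the example with two solutions. -/
def exampleData (α₁ α₂ : ℝ) : Data where
  Ω := Ioo 0 1
  Φ₀ := fun _ => 0
  f := fun x => α₁ * π ^ 2 * sin (π * x)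
  φ := fun x => α₂ * (10 * π ^ 2 * sin (π * x) / (5 - cos (2 * π * x)))
  k := π ^ 2
  g := fun s => 4 / α₁ * (min 0 s) ^ 2
  Ψ₀ := fun _ => 0
  ψ := fun x => 5 * π ^ 2 * sin (π * x) / (5 - cos (2 * π * x))

end ThermoQVI

end

/-! Uniqueness of the temperature is a monotonicity argument: `g` is antitone and `ψ ≥ 0`, so
testing two equations with the difference of their solutions leaves a nonpositive right side and a
sum of squares on the left. At `u = 0` the obstacle is `0`, and `f ≥ 0` settles the inequality. At
`u = α₁ sin(πx)` the product `ψT` equals `u/2`, so the source is `g(-u/2) = α₁ sin²(πx)`, which is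
`kT - T''`. The obstacle is `α₂u ≥ u` and `-u'' = f`, so the variational inequality is an equality.
For the constants, `φ` and `ψ` are multiples of one `profile`, and `Lip(g, [-t,t]) = 8t/α₁`. Hence
the contraction factor is linear in `t > 0`, and the threshold for `R` is the positive root of a
quadratic. The analytic work is `MemH10.of_hasDerivAt`, which produces elements of `H₀¹`, and
`MemH10.integral_mul_weakDeriv`, which integrates by parts. -/

namespace ThermoQVI

/-! ### Weak derivatives and integration by parts -/

section Sobolev

variable {Ω : Set ℝ} {u u' v v' η : ℝ → ℝ}

theorem IsTestFunction.memLp (hη : IsTestFunction Ω η) {μ : Measure ℝ}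
    [IsFiniteMeasureOnCompacts μ] : MemLp η 2 μ :=
  hη.1.continuous.memLp_of_hasCompactSupport hη.2.1

theorem IsTestFunction.memLp_deriv (hη : IsTestFunction Ω η) {μ : Measure ℝ}
    [IsFiniteMeasureOnCompacts μ] : MemLp (deriv η) 2 μ :=
  (hη.1.continuous_deriv (by simp)).memLp_of_hasCompactSupport hη.2.1.deriv

theorem MemH1.sub (hu : MemH1 Ω u u') (hv : MemH1 Ω v v') :
    MemH1 Ω (fun x => u x - v x) (fun x => u' x - v' x) := by
  refine ⟨hu.1.sub hv.1, hu.2.1.sub hv.2.1, fun η hη => ?_⟩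
  have i₁ := hu.1.integrable_mul (hη.memLp_deriv (μ := volume.restrict Ω))
  have i₂ := hv.1.integrable_mul (hη.memLp_deriv (μ := volume.restrict Ω))
  have i₃ := hu.2.1.integrable_mul (hη.memLp (μ := volume.restrict Ω))
  have i₄ := hv.2.1.integrable_mul (hη.memLp (μ := volume.restrict Ω))
  have e₁ := integral_sub i₁ i₂
  have e₂ := integral_sub i₃ i₄
  simp only [Pi.mul_apply] at e₁ e₂
  simp only [sub_mul]
  rw [e₁, e₂, hu.2.2 η hη, hv.2.2 η hη]
  ring

/-- Hölder with exponents 2 and 2 turns `L²` convergence of `F n` into `L¹` convergence of the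
products with `z`. -/
theorem tendsto_integral_mul_of_tendsto_eLpNorm {μ : Measure ℝ} {w z : ℝ → ℝ} {F : ℕ → ℝ → ℝ}
    (hw : MemLp w 2 μ) (hz : MemLp z 2 μ) (hF : ∀ n, MemLp (F n) 2 μ)
    (h : Tendsto (fun n => eLpNorm (fun x => w x - F n x) 2 μ) atTop (𝓝 0)) :
    Tendsto (fun n => ∫ x, F n x * z x ∂μ) atTop (𝓝 (∫ x, w x * z x ∂μ)) := by
  refine tendsto_integral_of_L1' _ (hw.integrable_mul hz).aestronglyMeasurable
    (Eventually.of_forall fun n => (hF n).integrable_mul hz) ?_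
  have hb : Tendsto (fun n => eLpNorm (fun x => w x - F n x) 2 μ * eLpNorm z 2 μ) atTop
      (𝓝 0) := by
    simpa using ENNReal.Tendsto.mul_const h (Or.inr hz.2.ne)
  refine tendsto_of_tendsto_of_tendsto_of_le_of_le tendsto_const_nhds hb (fun n => zero_le)
    fun n => ?_
  have := eLpNorm_le_eLpNorm_mul_eLpNorm'_of_norm (p := 2) (q := 2) (r := 1)
    (hw.1.sub (hF n).1) hz.1 (fun a b : ℝ => a * b) 1
    (Eventually.of_forall fun x => by simp)
  refine le_trans (le_of_eq ?_) (this.trans (le_of_eq ?_))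
  · rw [← eLpNorm_neg]
    congr 1
    ext x
    simp
    ring
  · simp
    rfl

/-- Integration by parts for `w ∈ H₀¹(Ω)` and `z ∈ H¹(Ω)`. -/
theorem MemH10.integral_mul_weakDeriv {w w' z z' : ℝ → ℝ} (hw : MemH10 Ω w w')
    (hz : MemH1 Ω z z') : ∫ x in Ω, w x * z' x = - ∫ x in Ω, w' x * z x := by
  obtain ⟨⟨hw₁, hw₂, -⟩, η, hη, h₁, h₂⟩ := hw
  have l₁ := tendsto_integral_mul_of_tendsto_eLpNorm hw₁ hz.2.1 (fun n => (hη n).memLp) h₁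
  have l₂ := tendsto_integral_mul_of_tendsto_eLpNorm hw₂ hz.1 (fun n => (hη n).memLp_deriv) h₂
  refine tendsto_nhds_unique l₁ (l₂.neg.congr fun n => ?_)
  have := hz.2.2 _ (hη n)
  simp only [mul_comm (deriv (η n) _), mul_comm (η n _), this, neg_neg]

theorem MemH10.zero : MemH10 Ω (fun _ => 0) (fun _ => 0) := by
  refine ⟨⟨MemLp.zero', MemLp.zero', fun η _ => by simp⟩, fun _ _ => 0, fun n => ?_, ?_, ?_⟩
  · exact ⟨contDiff_const, HasCompactSupport.zero, by simp [tsupport]⟩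
  · simp
  · simp

end Sobolev

/-! ### Membership in `H¹(0,1)` and `H₀¹(0,1)` for classical functions -/

section UnitInterval

theorem memLp_Ioo_of_continuous {w : ℝ → ℝ} (hw : Continuous w) (a b : ℝ) (p : ℝ≥0∞) :
    MemLp w p (volume.restrict (Ioo a b)) := by
  obtain ⟨C, hC⟩ := isCompact_Icc.exists_bound_of_continuousOn (s := Icc a b) hw.continuousOn
  refine MemLp.of_bound hw.aestronglyMeasurable C ?_
  filter_upwards [ae_restrict_mem measurableSet_Ioo] with x hx
  exact hC x (Ioo_subset_Icc_self hx)

/-- The support of `η` lies in the open interval, so `η` kills both boundary terms; `w` itself need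
not vanish at the ends. -/
theorem MemH1.of_hasDerivAt {w w' : ℝ → ℝ} (h : ∀ x, HasDerivAt w (w' x) x)
    (hw' : Continuous w') : MemH1 (Ioo 0 1) w w' := by
  have hw : Continuous w := continuous_iff_continuousAt.2 fun x => (h x).continuousAt
  refine ⟨memLp_Ioo_of_continuous hw _ _ _, memLp_Ioo_of_continuous hw' _ _ _, fun η hη => ?_⟩
  have h0 : η 0 = 0 := image_eq_zero_of_notMem_tsupport fun h => by simpa using hη.2.2 h
  have h1 : η 1 = 0 := image_eq_zero_of_notMem_tsupport fun h => by simpa using hη.2.2 h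
  have hd : Continuous (deriv η) := hη.1.continuous_deriv (by simp)
  have := intervalIntegral.integral_mul_deriv_eq_deriv_mul (a := 0) (b := 1)
    (fun x _ => h x) (fun x _ => (hη.1.differentiable (by simp) x).hasDerivAt)
    (hw'.intervalIntegrable _ _) (hd.intervalIntegrable _ _)
  rw [h0, h1] at this
  simpa [intervalIntegral.integral_of_le, integral_Ioc_eq_integral_Ioo] using this

theorem tendsto_eLpNorm_zero_of_bounded {μ : Measure ℝ} [IsFiniteMeasure μ] {F : ℕ → ℝ → ℝ}
    {C : ℝ} (hF : ∀ n, Continuous (F n)) (hC : ∀ n, ∀ᵐ x ∂μ, |F n x| ≤ C)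
    (h : ∀ᵐ x ∂μ, Tendsto (fun n => F n x) atTop (𝓝 0)) :
    Tendsto (fun n => eLpNorm (F n) 2 μ) atTop (𝓝 0) := by
  have key : Tendsto (fun n => ∫⁻ x, ‖F n x‖ₑ ^ (2 : ℝ) ∂μ) atTop (𝓝 (∫⁻ _, 0 ∂μ)) := by
    refine tendsto_lintegral_of_dominated_convergence' (fun _ => ENNReal.ofReal C ^ (2 : ℝ))
      (fun n => by have := (hF n).measurable; fun_prop) (fun n => ?_) ?_ ?_
    · filter_upwards [hC n] with x hx
      gcongr
      rw [Real.enorm_eq_ofReal_abs]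
      exact ENNReal.ofReal_le_ofReal hx
    · rw [lintegral_const]
      exact ENNReal.mul_ne_top (ENNReal.rpow_ne_top_of_nonneg (by norm_num) ENNReal.ofReal_ne_top)
        (measure_ne_top _ _)
    · filter_upwards [h] with x hx
      have := (ENNReal.continuous_rpow_const (y := (2 : ℝ))).tendsto _ |>.comp hx.enorm
      simpa [Function.comp_def] using this
  have := (ENNReal.continuous_rpow_const (y := (1 / 2 : ℝ))).tendsto _ |>.comp key
  simp only [lintegral_zero] at this
  rw [ENNReal.zero_rpow_of_pos (by norm_num)] at this
  refine this.congr fun n => ?_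
  simp [eLpNorm_eq_lintegral_rpow_enorm_toReal]

/-- A smooth cutoff of the unit interval. -/
noncomputable def cutoff (n : ℕ) (x : ℝ) : ℝ := smoothTransition (n * (x * (1 - x)) - 1)

theorem cutoff_hasDerivAt (n : ℕ) (x : ℝ) :
    HasDerivAt (cutoff n)
      (deriv smoothTransition (n * (x * (1 - x)) - 1) * (n * (1 - 2 * x))) x := by
  have h₁ : HasDerivAt (fun x : ℝ => n * (x * (1 - x)) - 1) (n * (1 - 2 * x)) x := by
    have := (((hasDerivAt_id x).mul ((hasDerivAt_id x).const_sub 1)).const_mul (n : ℝ)).sub_const 1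
    refine this.congr_deriv ?_
    simp only [id]
    ring
  have h₂ : DifferentiableAt ℝ smoothTransition (n * (x * (1 - x)) - 1) :=
    (smoothTransition.contDiffAt (n := 1)).differentiableAt (by simp)
  exact h₂.hasDerivAt.comp x h₁

theorem cutoff_eq_zero {n : ℕ} {x : ℝ} (h : n * (x * (1 - x)) ≤ 1) : cutoff n x = 0 :=
  smoothTransition.zero_of_nonpos (by linarith)

/-- The support lies in the closed set `n x (1 - x) ≥ 1`, which keeps away from both endpoints. -/
theorem isTestFunction_mul_cutoff {w : ℝ → ℝ} (hw : ContDiff ℝ ∞ w) (n : ℕ) :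
    IsTestFunction (Ioo 0 1) (fun x => w x * cutoff n x) := by
  have hs : ContDiff ℝ ∞ (cutoff n) :=
    (smoothTransition.contDiff (n := ⊤)).comp (by fun_prop)
  have hK : tsupport (fun x => w x * cutoff n x) ⊆ {x | 1 ≤ n * (x * (1 - x))} := by
    refine closure_minimal (fun x hx => ?_) (isClosed_le (by fun_prop) (by fun_prop))
    by_contra hlt
    exact hx (by simp [cutoff_eq_zero (not_le.1 hlt).le])
  have hI : {x : ℝ | 1 ≤ n * (x * (1 - x))} ⊆ Ioo 0 1 := by
    intro x hx
    have hx : 1 ≤ n * (x * (1 - x)) := hx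
    have h : 0 < x * (1 - x) := by
      by_contra hle
      have := mul_nonpos_of_nonneg_of_nonpos (Nat.cast_nonneg (α := ℝ) n) (not_lt.1 hle)
      linarith
    constructor <;> nlinarith
  refine ⟨hw.mul hs, ?_, hK.trans hI⟩
  exact HasCompactSupport.of_support_subset_isCompact isCompact_Icc
    (subset_closure.trans ((hK.trans hI).trans Ioo_subset_Icc_self))

/-- The transition is constant off `[0,1]`. For the cutoffs this confines the derivative to `1 ≤ n x
(1 - x) ≤ 2`. -/
theorem exists_bound_deriv_smoothTransition :
    ∃ C, 0 ≤ C ∧ (∀ s, |deriv smoothTransition s| ≤ C) ∧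
      ∀ s, s ∉ Icc (0 : ℝ) 1 → deriv smoothTransition s = 0 := by
  have h0 : ∀ s, s ∉ Icc (0 : ℝ) 1 → deriv smoothTransition s = 0 := by
    intro s hs
    rcases lt_or_ge s 0 with h | h
    · have : smoothTransition =ᶠ[𝓝 s] fun _ => 0 := by
        filter_upwards [Iio_mem_nhds h] with t ht
        exact smoothTransition.zero_of_nonpos (le_of_lt ht)
      simp [this.deriv_eq]
    · have h : 1 < s := by
        by_contra hs'
        exact hs ⟨h, not_lt.1 hs'⟩
      have : smoothTransition =ᶠ[𝓝 s] fun _ => 1 := by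
        filter_upwards [Ioi_mem_nhds h] with t ht
        exact smoothTransition.one_of_one_le (le_of_lt ht)
      simp [this.deriv_eq]
  have hc : Continuous (deriv smoothTransition) :=
    (smoothTransition.contDiff (n := 1)).continuous_deriv le_rfl
  obtain ⟨C, hC⟩ := isCompact_Icc.exists_bound_of_continuousOn (s := Icc (0 : ℝ) 1) hc.continuousOn
  refine ⟨|C|, abs_nonneg C, fun s => ?_, h0⟩
  by_cases hs : s ∈ Icc (0 : ℝ) 1
  · exact (hC s hs).trans (le_abs_self C)
  · simp [h0 s hs]

/-- A smooth function vanishing at both ends of the unit interval lies in `H₀¹`. -/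
theorem MemH10.of_hasDerivAt {w w' : ℝ → ℝ} (hw : ContDiff ℝ ∞ w)
    (h : ∀ x, HasDerivAt w (w' x) x) {L : ℝ}
    (hL : ∀ x ∈ Ioo (0 : ℝ) 1, |w x| ≤ L * (x * (1 - x))) : MemH10 (Ioo 0 1) w w' := by
  have hcw : Continuous w := hw.continuous
  have hcw' : Continuous w' := by
    have : w' = deriv w := funext fun x => (h x).deriv.symm
    rw [this]
    exact hw.continuous_deriv (by simp)
  have hcs : Continuous (deriv smoothTransition) :=
    (smoothTransition.contDiff (n := 1)).continuous_deriv le_rfl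
  obtain ⟨C, hC0, hC, hz⟩ := exists_bound_deriv_smoothTransition
  obtain ⟨A, hA⟩ := isCompact_Icc.exists_bound_of_continuousOn (s := Icc (0 : ℝ) 1)
    hcw.continuousOn
  obtain ⟨B, hB⟩ := isCompact_Icc.exists_bound_of_continuousOn (s := Icc (0 : ℝ) 1)
    hcw'.continuousOn
  have hcut : ∀ n x, |1 - cutoff n x| ≤ 1 := fun n x => by
    have h₁ := smoothTransition.nonneg (n * (x * (1 - x)) - 1)
    have h₂ := smoothTransition.le_one (n * (x * (1 - x)) - 1)
    rw [abs_le]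
    constructor <;> simp only [cutoff] <;> linarith
  have hccut : ∀ n, Continuous (cutoff n) := fun n =>
    continuous_iff_continuousAt.2 fun x => (cutoff_hasDerivAt n x).continuousAt
  have hev : ∀ x ∈ Ioo (0 : ℝ) 1, ∀ᶠ n : ℕ in atTop, 2 < n * (x * (1 - x)) := by
    intro x hx
    have hpos : 0 < x * (1 - x) := mul_pos hx.1 (by linarith [hx.2])
    exact (tendsto_natCast_atTop_atTop.atTop_mul_const hpos).eventually_gt_atTop 2
  have hone : ∀ {n : ℕ} {x : ℝ}, 2 < n * (x * (1 - x)) → cutoff n x = 1 := fun h =>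
    smoothTransition.one_of_one_le (by linarith)
  refine ⟨MemH1.of_hasDerivAt h hcw', fun n x => w x * cutoff n x,
    isTestFunction_mul_cutoff hw, ?_, ?_⟩
  · refine tendsto_eLpNorm_zero_of_bounded (C := A) (fun n => by have := hccut n; fun_prop)
      (fun n => ?_) ?_
    · filter_upwards [ae_restrict_mem measurableSet_Ioo] with x hx
      have := mul_le_mul (hA x (Ioo_subset_Icc_self hx)) (hcut n x) (abs_nonneg _)
        ((norm_nonneg _).trans (hA x (Ioo_subset_Icc_self hx)))
      rw [Real.norm_eq_abs, ← abs_mul, mul_one] at this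
      simpa [mul_sub] using this
    · filter_upwards [ae_restrict_mem measurableSet_Ioo] with x hx
      refine tendsto_const_nhds.congr' ?_
      filter_upwards [hev x hx] with n hn
      simp [hone hn]
  · have hd : ∀ n x, w' x - deriv (fun x => w x * cutoff n x) x =
        w' x * (1 - cutoff n x) -
          w x * (deriv smoothTransition (n * (x * (1 - x)) - 1) * (n * (1 - 2 * x))) := by
      intro n x
      have := ((h x).mul (cutoff_hasDerivAt n x)).deriv
      simp only [Pi.mul_def] at this
      rw [this]
      ring
    simp only [hd]
    -- The cutoff's derivative is of order `n`, but where it is nonzero `x (1 - x) ≤ 2 / n`, so the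
    -- linear decay of `w` at the ends gives `|w| n ≤ 2|L|`. This uniform bound permits dominated
    -- convergence.
    refine tendsto_eLpNorm_zero_of_bounded (C := B + 2 * |L| * C)
      (fun n => by have := hccut n; fun_prop) (fun n => ?_) ?_
    · filter_upwards [ae_restrict_mem measurableSet_Ioo] with x hx
      refine (abs_sub _ _).trans (add_le_add ?_ ?_)
      · have := mul_le_mul (hB x (Ioo_subset_Icc_self hx)) (hcut n x) (abs_nonneg _)
          ((norm_nonneg _).trans (hB x (Ioo_subset_Icc_self hx)))
        rwa [Real.norm_eq_abs, ← abs_mul, mul_one] at this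
      · by_cases hs : n * (x * (1 - x)) - 1 ∈ Icc (0 : ℝ) 1
        · have hpos : 0 < x * (1 - x) := mul_pos hx.1 (by linarith [hx.2])
          have h₁ : |w x| * n ≤ 2 * |L| := by
            calc |w x| * n ≤ |L| * (x * (1 - x)) * n := by
                  gcongr
                  exact (hL x hx).trans (by gcongr; exact le_abs_self L)
              _ = |L| * (n * (x * (1 - x))) := by ring
              _ ≤ |L| * 2 := by gcongr; linarith [hs.2]
              _ = 2 * |L| := by ring
          have h₂ : |1 - 2 * x| ≤ 1 := abs_le.2 ⟨by linarith [hx.2], by linarith [hx.1]⟩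
          calc |w x * (deriv smoothTransition (n * (x * (1 - x)) - 1) * (n * (1 - 2 * x)))|
              = |w x| * n * |deriv smoothTransition (n * (x * (1 - x)) - 1)| * |1 - 2 * x| := by
                simp only [abs_mul, Nat.abs_cast]
                ring
            _ ≤ 2 * |L| * C * 1 := by
                gcongr
                exact hC _
            _ = 2 * |L| * C := mul_one _
        · rw [hz _ hs]
          simp only [zero_mul, mul_zero, abs_zero]
          positivity
    · filter_upwards [ae_restrict_mem measurableSet_Ioo] with x hx
      refine tendsto_const_nhds.congr' ?_
      filter_upwards [hev x hx] with n hn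
      rw [hone hn, hz _ (fun hs => by linarith [hs.2])]
      simp

/-- On each half of the interval, `sin y ≤ y` is applied from the nearer endpoint; the other factor
is at least `1/2`, hence the constant `2π`. -/
theorem abs_sin_pi_mul_le {x : ℝ} (hx : x ∈ Ioo (0 : ℝ) 1) :
    |sin (π * x)| ≤ 2 * π * (x * (1 - x)) := by
  have h₀ := sin_nonneg_of_nonneg_of_le_pi (x := π * x) (by have := hx.1; positivity)
    (by nlinarith [pi_pos, hx.2])
  rw [abs_of_nonneg h₀]
  rcases le_total x (1 / 2) with h | h
  · have := sin_le (x := π * x) (by have := hx.1; positivity)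
    nlinarith [mul_nonneg (mul_nonneg pi_pos.le hx.1.le) (by linarith : 0 ≤ 1 - 2 * x)]
  · have := sin_le (x := π - π * x) (by nlinarith [pi_pos, hx.2])
    rw [sin_pi_sub] at this
    nlinarith [mul_nonneg (mul_nonneg pi_pos.le (sub_nonneg.2 hx.2.le))
      (by linarith : 0 ≤ 2 * x - 1)]

end UnitInterval

/-! ### Uniqueness of the temperature -/

section Temperature

/-- If `g` is antitone and `ψ ≥ 0`, the temperature equation has at most one weak solution. -/
theorem Data.IsTemperature.isTheTemperature {D : Data} {u T : ℝ → ℝ} (hΩ : MeasurableSet D.Ω)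
    (hk : 0 < D.k) (hg : Antitone D.g) (hψ : ∀ x ∈ D.Ω, 0 ≤ D.ψ x) (hT : D.IsTemperature u T) :
    D.IsTheTemperature u T := by
  refine ⟨hT, fun S hS => ?_⟩
  obtain ⟨hgT, T', hT₁, hT₂⟩ := hT
  obtain ⟨hgS, S', hS₁, hS₂⟩ := hS
  have hd := hS₁.sub hT₁
  have eS := hS₂ _ _ hd
  have eT := hT₂ _ _ hd
  have weak_int : ∀ {V V' : ℝ → ℝ}, MemH1 D.Ω V V' → Integrable
      (fun x => D.k * V x * (S x - T x) + V' x * (S' x - T' x)) (volume.restrict D.Ω) :=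
    fun hV => ((hV.1.const_mul D.k).integrable_mul hd.1).add (hV.2.1.integrable_mul hd.2.1)
  have hsub := integral_sub (weak_int hS₁) (weak_int hT₁)
  have hsub' := integral_sub (hgS.integrable_mul hd.1) (hgT.integrable_mul hd.1)
  simp only [Pi.mul_apply] at hsub'
  rw [eS, eT, ← hsub'] at hsub
  -- Pointwise, the increment of `g` and `S - T` have opposite signs.
  have hle : ∫ x in D.Ω, (D.g (D.Ψ₀ x + D.ψ x * S x - u x) * (S x - T x) -
      D.g (D.Ψ₀ x + D.ψ x * T x - u x) * (S x - T x)) ≤ 0 := by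
    refine integral_nonpos_of_ae ?_
    filter_upwards [ae_restrict_mem hΩ] with x hx
    rw [← sub_mul]
    have hψx := hψ x hx
    rcases le_total (S x) (T x) with h | h
    · have := hg (show D.Ψ₀ x + D.ψ x * S x - u x ≤ D.Ψ₀ x + D.ψ x * T x - u x by gcongr)
      exact mul_nonpos_of_nonneg_of_nonpos (by linarith) (by linarith)
    · have := hg (show D.Ψ₀ x + D.ψ x * T x - u x ≤ D.Ψ₀ x + D.ψ x * S x - u x by gcongr)
      exact mul_nonpos_of_nonpos_of_nonneg (by linarith) (by linarith)
  rw [← hsub] at hle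
  have hnn : ∀ x, 0 ≤ D.k * S x * (S x - T x) + S' x * (S' x - T' x) -
      (D.k * T x * (S x - T x) + T' x * (S' x - T' x)) := fun x => by
    have : D.k * S x * (S x - T x) + S' x * (S' x - T' x) -
        (D.k * T x * (S x - T x) + T' x * (S' x - T' x)) =
        D.k * (S x - T x) ^ 2 + (S' x - T' x) ^ 2 := by ring
    rw [this]
    positivity
  have hzero := (integral_eq_zero_iff_of_nonneg hnn ((weak_int hS₁).sub (weak_int hT₁))).1
    (le_antisymm hle (integral_nonneg hnn))
  filter_upwards [hzero] with x hx
  have h₀ : D.k * (S x - T x) ^ 2 + (S' x - T' x) ^ 2 = 0 := by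
    simp only [Pi.zero_apply] at hx
    linarith
  have h₁ : (S x - T x) ^ 2 = 0 := by
    have := mul_nonneg hk.le (sq_nonneg (S x - T x))
    have h₂ : D.k * (S x - T x) ^ 2 = 0 := by linarith [sq_nonneg (S' x - T' x)]
    exact (mul_eq_zero.1 h₂).resolve_left hk.ne'
  linarith [pow_eq_zero_iff (two_ne_zero) |>.1 h₁]

end Temperature

/-! ### The two solutions -/

section Example

variable {α₁ α₂ : ℝ}

theorem sin_pi_mul_nonneg {x : ℝ} (hx : x ∈ Icc (0 : ℝ) 1) : 0 ≤ sin (π * x) :=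
  sin_nonneg_of_nonneg_of_le_pi (mul_nonneg pi_pos.le hx.1)
    (mul_le_of_le_one_right pi_pos.le hx.2)

theorem five_sub_cos_eq (x : ℝ) : 5 - cos (2 * π * x) = 4 + 2 * sin (π * x) ^ 2 := by
  rw [mul_assoc, cos_two_mul, cos_sq']
  ring

theorem five_sub_cos_pos (x : ℝ) : 0 < 5 - cos (2 * π * x) := by
  linarith [cos_le_one (2 * π * x)]

theorem exampleData_g_antitone (hα₁ : 0 < α₁) : Antitone (exampleData α₁ α₂).g := by
  intro s t hst
  simp only [exampleData]
  gcongr 4 / α₁ * ?_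
  nlinarith [min_le_min_left 0 hst, min_le_left 0 s, min_le_left 0 t]

theorem exampleData_isTheTemperature (hα₁ : 0 < α₁) {u T : ℝ → ℝ}
    (hT : (exampleData α₁ α₂).IsTemperature u T) : (exampleData α₁ α₂).IsTheTemperature u T := by
  refine hT.isTheTemperature measurableSet_Ioo (pow_pos pi_pos 2) (exampleData_g_antitone hα₁)
    fun x hx => ?_
  have := sin_pi_mul_nonneg (Ioo_subset_Icc_self hx)
  have := five_sub_cos_pos x
  simp only [exampleData]
  positivity

theorem hasDerivAt_sin_const_mul (c x : ℝ) :
    HasDerivAt (fun x => sin (c * x)) (c * cos (c * x)) x := by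
  have := ((hasDerivAt_id x).const_mul c).sin
  simpa [mul_comm] using this

theorem hasDerivAt_cos_const_mul (c x : ℝ) :
    HasDerivAt (fun x => cos (c * x)) (-(c * sin (c * x))) x := by
  have := ((hasDerivAt_id x).const_mul c).cos
  simpa [mul_comm] using this

theorem exampleData_isSolution_zero (hα₁ : 0 < α₁) :
    (exampleData α₁ α₂).IsSolution (fun _ => 0) (fun _ => 0) := by
  refine ⟨exampleData_isTheTemperature hα₁ ⟨?_, fun _ => 0, MemH10.zero.1, fun ζ ζ' _ => ?_⟩,
    fun _ => 0, MemH10.zero, ?_, fun v v' _ hv => ?_⟩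
  · simp [exampleData]
  · simp [exampleData]
  · simp [exampleData]
  · have : ∫ x in Ioo 0 1, (exampleData α₁ α₂).f x * (v x - 0) ≤ 0 := by
      refine integral_nonpos_of_ae ?_
      filter_upwards [hv, ae_restrict_mem measurableSet_Ioo] with x hx hx'
      have h₁ : v x ≤ 0 := by simpa [exampleData] using hx
      have h₂ := sin_pi_mul_nonneg (Ioo_subset_Icc_self hx')
      simp only [exampleData, sub_zero]
      exact mul_nonpos_of_nonneg_of_nonpos (by positivity) h₁
    simpa [exampleData] using this

theorem exampleData_isTemperature_sin (hα₁ : 0 < α₁) :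
    (exampleData α₁ α₂).IsTemperature (fun x => α₁ * sin (π * x))
      (fun x => α₁ * ((5 - cos (2 * π * x)) / (10 * π ^ 2))) := by
  have hg : ∀ x ∈ Ioo (0 : ℝ) 1, (exampleData α₁ α₂).g ((exampleData α₁ α₂).Ψ₀ x +
      (exampleData α₁ α₂).ψ x * (α₁ * ((5 - cos (2 * π * x)) / (10 * π ^ 2))) -
        α₁ * sin (π * x)) = α₁ * sin (π * x) ^ 2 := by
    intro x hx
    have hs := sin_pi_mul_nonneg (Ioo_subset_Icc_self hx)
    have hc := (five_sub_cos_pos x).ne'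
    have : 0 + 5 * π ^ 2 * sin (π * x) / (5 - cos (2 * π * x)) *
        (α₁ * ((5 - cos (2 * π * x)) / (10 * π ^ 2))) - α₁ * sin (π * x) =
        -(α₁ * sin (π * x) / 2) := by
      generalize 5 - cos (2 * π * x) = c at hc ⊢
      field_simp
      ring
    simp only [exampleData, this]
    rw [min_eq_right (neg_nonpos.2 (by positivity))]
    field_simp
    ring
  have hT : ∀ x, HasDerivAt (fun x => α₁ * ((5 - cos (2 * π * x)) / (10 * π ^ 2)))
      (α₁ / (5 * π) * sin (2 * π * x)) x := fun x => by
    refine ((((hasDerivAt_cos_const_mul (2 * π) x).const_sub 5).div_const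
      (10 * π ^ 2)).const_mul α₁).congr_deriv ?_
    field_simp
    ring
  have hT' : ∀ x, HasDerivAt (fun x => α₁ / (5 * π) * sin (2 * π * x))
      (2 * α₁ / 5 * cos (2 * π * x)) x := fun x => by
    refine ((hasDerivAt_sin_const_mul (2 * π) x).const_mul _).congr_deriv ?_
    field_simp
  -- The Neumann condition enters as `T' ∈ H₀¹`: integrating `T' ζ'` by parts then leaves no
  -- boundary term, although `ζ` is only in `H¹`.
  have hT₀ : MemH10 (Ioo 0 1) (fun x => α₁ / (5 * π) * sin (2 * π * x))
      (fun x => 2 * α₁ / 5 * cos (2 * π * x)) := by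
    refine MemH10.of_hasDerivAt (by fun_prop) hT' (L := α₁ / (5 * π) * (2 * (2 * π)))
      fun x hx => ?_
    have h₁ := abs_sin_pi_mul_le hx
    have h₂ := abs_cos_le_one (π * x)
    rw [mul_assoc 2 π x, sin_two_mul, abs_mul, abs_mul, abs_mul, abs_two,
      abs_of_pos (show 0 < α₁ / (5 * π) by positivity)]
    calc α₁ / (5 * π) * (2 * |sin (π * x)| * |cos (π * x)|)
        ≤ α₁ / (5 * π) * (2 * |sin (π * x)| * 1) := by gcongr
      _ ≤ α₁ / (5 * π) * (2 * (2 * π * (x * (1 - x))) * 1) := by gcongr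
      _ = _ := by ring
  refine ⟨?_, _, MemH1.of_hasDerivAt hT (by fun_prop), fun ζ ζ' hζ => ?_⟩
  · refine MemLp.ae_eq ?_ (memLp_Ioo_of_continuous (w := fun x => α₁ * sin (π * x) ^ 2)
      (by fun_prop) 0 1 2)
    filter_upwards [ae_restrict_mem measurableSet_Ioo] with x hx
    exact (hg x hx).symm
  · have hparts := hT₀.integral_mul_weakDeriv hζ
    have hTi := (memLp_Ioo_of_continuous (w := fun x => π ^ 2 *
      (α₁ * ((5 - cos (2 * π * x)) / (10 * π ^ 2)))) (by fun_prop) 0 1 2).integrable_mul hζ.1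
    have hT'i := hT₀.1.1.integrable_mul hζ.2.1
    have hT''i := hT₀.1.2.1.integrable_mul hζ.1
    have e₁ := integral_add hTi hT'i
    have e₂ := integral_sub hTi hT''i
    simp only [Pi.mul_apply] at e₁ e₂
    refine e₁.trans ?_
    rw [hparts, ← sub_eq_add_neg, ← e₂]
    refine setIntegral_congr_fun measurableSet_Ioo fun x hx => ?_
    simp only
    rw [hg x hx, five_sub_cos_eq, show cos (2 * π * x) = 1 - 2 * sin (π * x) ^ 2 by
      linarith [five_sub_cos_eq x]]
    field_simp
    ring

theorem memH10_const_mul_sin (hα₁ : 0 < α₁) :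
    MemH10 (Ioo 0 1) (fun x => α₁ * sin (π * x)) (fun x => α₁ * π * cos (π * x)) := by
  refine MemH10.of_hasDerivAt (by fun_prop) (fun x => ?_) (L := α₁ * (2 * π)) fun x hx => ?_
  · exact ((hasDerivAt_sin_const_mul π x).const_mul α₁).congr_deriv (by ring)
  · rw [abs_mul, abs_of_pos hα₁, mul_assoc]
    gcongr
    exact abs_sin_pi_mul_le hx

theorem exampleData_isSolution_sin (hα₁ : 0 < α₁) (hα₂ : 1 ≤ α₂) :
    (exampleData α₁ α₂).IsSolution (fun x => α₁ * sin (π * x))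
      (fun x => α₁ * ((5 - cos (2 * π * x)) / (10 * π ^ 2))) := by
  have hu := memH10_const_mul_sin hα₁
  refine ⟨exampleData_isTheTemperature hα₁ (exampleData_isTemperature_sin hα₁), _, hu, ?_,
    fun v v' hv _ => ?_⟩
  · filter_upwards [ae_restrict_mem (s := Ioo (0 : ℝ) 1) measurableSet_Ioo] with x hx
    have hs := sin_pi_mul_nonneg (Ioo_subset_Icc_self hx)
    have hc := (five_sub_cos_pos x).ne'
    have : (exampleData α₁ α₂).Φ₀ x + (exampleData α₁ α₂).φ x *
        (α₁ * ((5 - cos (2 * π * x)) / (10 * π ^ 2))) = α₂ * (α₁ * sin (π * x)) := by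
      simp only [exampleData]
      generalize 5 - cos (2 * π * x) = c at hc ⊢
      field_simp
      ring
    rw [this]
    exact le_mul_of_one_le_left (by positivity) hα₂
  · have hu' : MemH1 (Ioo 0 1) (fun x => α₁ * π * cos (π * x))
        (fun x => -(α₁ * π ^ 2 * sin (π * x))) := by
      refine MemH1.of_hasDerivAt (fun x => ?_) (by fun_prop)
      exact ((hasDerivAt_cos_const_mul π x).const_mul (α₁ * π)).congr_deriv (by ring)
    have hv : MemH10 (Ioo 0 1) v v' := hv
    have e₁ := hv.integral_mul_weakDeriv hu'
    have e₂ := hu.integral_mul_weakDeriv hu'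
    have e₃ := integral_sub (hu'.1.integrable_mul hv.1.2.1) (hu'.1.integrable_mul hu.1.2.1)
    have hf := hu'.2.1.neg
    have e₄ := integral_sub (hf.integrable_mul hv.1.1) (hf.integrable_mul hu.1.1)
    simp only [Pi.mul_apply, Pi.neg_apply, neg_neg, ← mul_sub] at e₃ e₄
    simp only [exampleData]
    rw [e₃, e₄]
    simp only [mul_neg, integral_neg, neg_inj] at e₁ e₂
    simp only [mul_comm (α₁ * π ^ 2 * sin _), mul_comm (α₁ * π * cos _) (v' _)]
    linarith

theorem const_mul_sin_not_ae_eq_zero (hα₁ : 0 < α₁) :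
    ¬ ((fun x : ℝ => α₁ * sin (π * x)) =ᵐ[volume.restrict (Ioo 0 1)] fun _ => 0) := by
  intro h
  have hne : (0 : ℝ≥0∞) ≠ volume (Ioo (0 : ℝ) 1) := by simp
  rw [EventuallyEq, ae_restrict_iff' measurableSet_Ioo] at h
  refine hne (measure_mono_null (fun x hx => ?_) (ae_iff.1 h)).symm
  have : 0 < sin (π * x) := sin_pos_of_pos_of_lt_pi (mul_pos pi_pos hx.1)
    (mul_lt_of_lt_one_right pi_pos hx.2)
  have : α₁ * sin (π * x) ≠ 0 := by positivity
  simpa [hx.1, hx.2] using this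

end Example

/-! ### Norms, Lipschitz constant and critical radius -/

section Constants

/-- The maximiser may be an endpoint, as for `deriv profile`. A neighbourhood of it still meets the
open interval in positive measure, so the essential supremum sees the value. -/
theorem supNorm_eq_of_continuous {h : ℝ → ℝ} (hc : Continuous h) {C x₀ : ℝ}
    (hle : ∀ x ∈ Ioo (0 : ℝ) 1, |h x| ≤ C) (hx₀ : x₀ ∈ Icc (0 : ℝ) 1) (heq : |h x₀| = C) :
    supNorm (Ioo 0 1) h = C := by
  have hC : 0 ≤ C := heq ▸ abs_nonneg _
  have hle' : eLpNorm h ∞ (volume.restrict (Ioo 0 1)) ≤ ENNReal.ofReal C := by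
    refine eLpNormEssSup_le_of_ae_bound ?_
    filter_upwards [ae_restrict_mem measurableSet_Ioo] with x hx using hle x hx
  have hfin := (hle'.trans_lt ENNReal.ofReal_lt_top).ne
  refine le_antisymm (ENNReal.toReal_le_of_le_ofReal hC hle') (not_lt.1 fun hlt => ?_)
  rw [← heq] at hlt
  have hU : IsOpen {x | supNorm (Ioo 0 1) h < |h x|} := isOpen_lt continuous_const hc.abs
  have hx₀' : x₀ ∈ closure (Ioo (0 : ℝ) 1) := by
    rwa [closure_Ioo zero_ne_one]
  have hpos := (hU.inter isOpen_Ioo).measure_pos volume (mem_closure_iff.1 hx₀' _ hU hlt)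
  refine hpos.ne' ?_
  have hae := ae_le_eLpNormEssSup (f := h) (μ := volume.restrict (Ioo (0 : ℝ) 1))
  rw [ae_restrict_iff' measurableSet_Ioo] at hae
  refine measure_mono_null (fun x hx => ?_) (ae_iff.1 hae)
  simp only [mem_ofPred_eq, Classical.not_imp, not_le]
  refine ⟨hx.2, ?_⟩
  rw [Real.enorm_eq_ofReal_abs, ← eLpNorm_exponent_top]
  exact (ENNReal.lt_ofReal_iff_toReal_lt hfin).2 hx.1

theorem supNorm_const_mul (Ω : Set ℝ) (c : ℝ) (h : ℝ → ℝ) :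
    supNorm Ω (fun x => c * h x) = |c| * supNorm Ω h := by
  have := eLpNorm_const_smul c h ∞ (volume.restrict Ω)
  simp only [supNorm]
  rw [show (fun x => c * h x) = c • h from rfl, this, ENNReal.toReal_mul]
  simp

/-- The common profile of `φ` and `ψ`. -/
noncomputable def profile (x : ℝ) : ℝ := sin (π * x) / (5 - cos (2 * π * x))

theorem profile_hasDerivAt (x : ℝ) : HasDerivAt profile
    (π * (cos (π * x) * (4 - 2 * sin (π * x) ^ 2) / (4 + 2 * sin (π * x) ^ 2) ^ 2)) x := by
  have h := (hasDerivAt_sin_const_mul π x).div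
    ((hasDerivAt_cos_const_mul (2 * π) x).const_sub 5) (five_sub_cos_pos x).ne'
  refine h.congr_deriv ?_
  rw [five_sub_cos_eq, mul_assoc 2 π x, sin_two_mul]
  have : (4 + 2 * sin (π * x) ^ 2) ^ 2 ≠ 0 := by positivity
  field_simp
  ring

/-- With `s = |sin(πx)|`, the bound `6s ≤ 4 + 2s²` is `(s - 1)(s - 2) ≥ 0`, with equality at `s =
1`. -/
theorem supNorm_profile : supNorm (Ioo 0 1) profile = 1 / 6 := by
  refine supNorm_eq_of_continuous (x₀ := 1 / 2)
    (continuous_iff_continuousAt.2 fun x => (profile_hasDerivAt x).continuousAt)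
    (fun x _ => ?_) (by constructor <;> norm_num) ?_
  · simp only [profile]
    have h := five_sub_cos_pos x
    rw [abs_div, abs_of_pos h, div_le_iff₀ h, five_sub_cos_eq]
    rw [← sq_abs]
    nlinarith [abs_nonneg (sin (π * x)), abs_sin_le_one (π * x)]
  · have h₁ : π * (1 / 2) = π / 2 := by ring
    rw [profile, five_sub_cos_eq, h₁, sin_pi_div_two]
    norm_num

/-- The numerator is at most 4 and the denominator at least 16, both attained at the endpoint 0. -/
theorem supNorm_deriv_profile : supNorm (Ioo 0 1) (deriv profile) = π / 4 := by
  have hd : deriv profile = fun x =>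
      π * (cos (π * x) * (4 - 2 * sin (π * x) ^ 2) / (4 + 2 * sin (π * x) ^ 2) ^ 2) :=
    funext fun x => (profile_hasDerivAt x).deriv
  have hpos : ∀ x, 0 < 4 + 2 * sin (π * x) ^ 2 := fun x => by positivity
  rw [hd]
  refine supNorm_eq_of_continuous (x₀ := 0) ?_ (fun x _ => ?_) (by simp) ?_
  · have := fun x => (pow_pos (hpos x) 2).ne'
    fun_prop (disch := assumption)
  · have hs : sin (π * x) ^ 2 ≤ 1 := sin_sq_le_one _
    have hs0 := sq_nonneg (sin (π * x))
    have h₁ : |4 - 2 * sin (π * x) ^ 2| ≤ 4 := abs_le.2 ⟨by linarith, by linarith⟩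
    rw [abs_mul, abs_of_pos pi_pos, abs_div, abs_of_pos (pow_pos (hpos x) 2), abs_mul,
      show π / 4 = π * (1 / 4) by ring]
    refine mul_le_mul_of_nonneg_left ?_ pi_pos.le
    rw [div_le_iff₀ (pow_pos (hpos x) 2)]
    calc |cos (π * x)| * |4 - 2 * sin (π * x) ^ 2| ≤ 1 * 4 := by
          gcongr
          exact abs_cos_le_one _
      _ ≤ 1 / 4 * (4 + 2 * sin (π * x) ^ 2) ^ 2 := by nlinarith
  · simp
    rw [abs_of_pos pi_pos]
    ring

variable {α₁ α₂ : ℝ}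

theorem supNorm_exampleData_ψ :
    supNorm (exampleData α₁ α₂).Ω (exampleData α₁ α₂).ψ = 5 * π ^ 2 / 6 := by
  have : (exampleData α₁ α₂).ψ = fun x => 5 * π ^ 2 * profile x :=
    funext fun x => mul_div_assoc _ _ _
  rw [this, supNorm_const_mul]
  simp only [exampleData]
  rw [supNorm_profile, abs_of_pos (by positivity)]
  ring

theorem exampleData_φ_eq :
    (exampleData α₁ α₂).φ = fun x => α₂ * (10 * π ^ 2) * profile x := by
  funext x
  simp only [exampleData, profile]
  ring

theorem supNorm_exampleData_φ (hα₂ : 0 < α₂) :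
    supNorm (exampleData α₁ α₂).Ω (exampleData α₁ α₂).φ = 5 * π ^ 2 * α₂ / 3 := by
  rw [exampleData_φ_eq, supNorm_const_mul]
  simp only [exampleData]
  rw [supNorm_profile, abs_of_pos (by positivity)]
  ring

theorem supNorm_deriv_exampleData_φ (hα₂ : 0 < α₂) :
    supNorm (exampleData α₁ α₂).Ω (deriv (exampleData α₁ α₂).φ) = 5 * π ^ 3 * α₂ / 2 := by
  have : deriv (exampleData α₁ α₂).φ = fun x => α₂ * (10 * π ^ 2) * deriv profile x := by
    rw [exampleData_φ_eq]
    exact funext fun x => deriv_const_mul _ (profile_hasDerivAt x).differentiableAt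
  rw [this, supNorm_const_mul]
  simp only [exampleData]
  rw [supNorm_deriv_profile, abs_of_pos (by positivity)]
  ring

/-- The upper bound factors a difference of squares; the lower bound takes secant slopes at the left
end `-t`, where `g` is steepest. -/
theorem lipConst_exampleData_g (hα₁ : 0 < α₁) {t : ℝ} (ht : 0 < t) :
    lipConst (exampleData α₁ α₂).g (-t) t = 8 / α₁ * t := by
  have hmem : 8 / α₁ * t ∈ {c : ℝ | 0 ≤ c ∧ ∀ s ∈ Icc (-t) t, ∀ r ∈ Icc (-t) t,
      |(exampleData α₁ α₂).g s - (exampleData α₁ α₂).g r| ≤ c * |s - r|} := by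
    refine ⟨by positivity, fun s hs r hr => ?_⟩
    have h₁ : |min 0 s - min 0 r| ≤ |s - r| := by
      simpa using abs_min_sub_min_le_max 0 s 0 r
    have h₂ : |min 0 s + min 0 r| ≤ 2 * t := by
      have := le_min (neg_nonpos.2 ht.le) hs.1
      have := le_min (neg_nonpos.2 ht.le) hr.1
      exact abs_le.2 ⟨by linarith, by linarith [min_le_left 0 s, min_le_left 0 r]⟩
    have h₃ : 4 / α₁ * min 0 s ^ 2 - 4 / α₁ * min 0 r ^ 2 =
        4 / α₁ * ((min 0 s + min 0 r) * (min 0 s - min 0 r)) := by ring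
    simp only [exampleData]
    rw [h₃, abs_mul, abs_mul, abs_of_pos (show 0 < 4 / α₁ by positivity)]
    calc 4 / α₁ * (|min 0 s + min 0 r| * |min 0 s - min 0 r|)
        ≤ 4 / α₁ * (2 * t * |s - r|) := by gcongr
      _ = 8 / α₁ * t * |s - r| := by ring
  refine le_antisymm (csInf_le ⟨0, fun c hc => hc.1⟩ hmem) (le_csInf ⟨_, hmem⟩ fun c hc => ?_)
  refine le_of_forall_pos_lt_add fun δ hδ => ?_
  -- `ε ≤ t` keeps `-t + ε` in the quadratic branch of `g`; `ε ≤ δα₁/8` makes the loss `4ε/α₁` in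
  -- the slope at most `δ/2`.
  have hε : 0 < min t (δ * α₁ / 8) := lt_min ht (by positivity)
  set ε := min t (δ * α₁ / 8)
  have hεt : ε ≤ t := min_le_left _ _
  have hεδ : ε ≤ δ * α₁ / 8 := min_le_right _ _
  have h := hc.2 (-t) ⟨le_rfl, by linarith⟩ (-t + ε) ⟨by linarith, by linarith⟩
  simp only [exampleData] at h
  rw [min_eq_right (by linarith), min_eq_right (by linarith),
    show -t - (-t + ε) = -ε by ring, abs_neg, abs_of_pos hε] at h
  have h' := (le_abs_self _).trans h
  have h'' : 4 / α₁ * (2 * t - ε) ≤ c := by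
    refine le_of_mul_le_mul_right ?_ hε
    linarith [show 4 / α₁ * (2 * t - ε) * ε = 4 / α₁ * (-t) ^ 2 - 4 / α₁ * (-t + ε) ^ 2 by ring]
  have h₅ : 4 / α₁ * ε ≤ δ / 2 := by
    calc 4 / α₁ * ε ≤ 4 / α₁ * (δ * α₁ / 8) := by gcongr
      _ = δ / 2 := by field_simp; ring
  linarith [show 4 / α₁ * (2 * t - ε) = 8 / α₁ * t - 4 / α₁ * ε by ring]

theorem pi_sq_rpow_neg_half : (π ^ 2) ^ (-(1 / 2) : ℝ) = π⁻¹ := by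
  rw [rpow_neg (by positivity), ← sqrt_eq_rpow, sqrt_sq pi_pos.le]

theorem exampleData_M (hα₁ : 0 < α₁) {R : ℝ} (hR : 0 < R) :
    (exampleData α₁ α₂).M R = 1 / 2 * R + 10 * (1 + π) / (3 * π * α₁) * R ^ 2 := by
  have hvol : volume.real (exampleData α₁ α₂).Ω = 1 := by simp [exampleData]
  have hN : (exampleData α₁ α₂).N R = R / 2 := by simp [Data.N, hvol]
  have hk : (exampleData α₁ α₂).k = π ^ 2 := rfl
  have hg : (exampleData α₁ α₂).g 0 = 0 := by simp [exampleData]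
  rw [Data.M, hN, hvol, supNorm_exampleData_ψ, lipConst_exampleData_g hα₁ (half_pos hR), hk, hg,
    pi_sq_rpow_neg_half, one_rpow, one_rpow, abs_zero]
  field_simp
  ring

theorem exampleData_contractionFactor (hα₁ : 0 < α₁) (hα₂ : 0 < α₂) {t : ℝ} (ht : 0 < t) :
    (exampleData α₁ α₂).contractionFactor t = 100 * α₂ / (3 * α₁) * t := by
  have hvol : volume.real (exampleData α₁ α₂).Ω = 1 := by simp [exampleData]
  have hk : (exampleData α₁ α₂).k = π ^ 2 := rfl
  rw [Data.contractionFactor, hvol, supNorm_exampleData_φ hα₂, supNorm_deriv_exampleData_φ hα₂,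
    lipConst_exampleData_g hα₁ ht, hk, pi_sq_rpow_neg_half]
  field_simp
  ring

theorem contraction_radius_iff (hα₁ : 0 < α₁) (hα₂ : 0 < α₂) {R : ℝ} (hR : 0 < R) :
    50 * α₂ / (3 * α₁) * (R + 20 * (1 + π) / (3 * π * α₁) * R ^ 2) ∈ Ico (0 : ℝ) 1 ↔
      R < 3 * α₁ / (10 * (1 + π)) *
        (√(((5 * α₂ + 8) * π ^ 2 + 8 * π) / (80 * α₂)) - π / 4) := by
  have hπ := pi_pos
  -- In the rescaled variable, completing the square gives `(y + π/4)²` against the radicand.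
  obtain ⟨y, rfl⟩ : ∃ y, R = 3 * α₁ / (10 * (1 + π)) * y :=
    ⟨R / (3 * α₁ / (10 * (1 + π))), by field_simp⟩
  have hy : 0 < y := pos_of_mul_pos_right hR (by positivity)
  rw [mul_lt_mul_iff_right₀ (by positivity), lt_sub_iff_add_lt, lt_sqrt (by positivity), mem_Ico,
    and_iff_right (by positivity), lt_div_iff₀ (by positivity)]
  have : 50 * α₂ / (3 * α₁) * (3 * α₁ / (10 * (1 + π)) * y +
      20 * (1 + π) / (3 * π * α₁) * (3 * α₁ / (10 * (1 + π)) * y) ^ 2) =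
      (5 * α₂ * (π * y + 2 * y ^ 2)) / (π * (1 + π)) := by
    field_simp
    ring
  rw [this, div_lt_one (by positivity)]
  constructor <;> intro h <;> nlinarith

end Constants

end ThermoQVI

theorem mainTheorem9 (α₁ α₂ : ℝ) (hα₁ : 0 < α₁) (hα₂ : 1 ≤ α₂) :
    (ThermoQVI.exampleData α₁ α₂).IsSolution (fun _ => 0) (fun _ => 0) ∧
    (ThermoQVI.exampleData α₁ α₂).IsSolution
      (fun x => α₁ * sin (π * x))
      (fun x => α₁ * ((5 - cos (2 * π * x)) / (10 * π ^ 2))) ∧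
    ¬ ((fun x : ℝ => α₁ * sin (π * x)) =ᵐ[volume.restrict (Ioo 0 1)] fun _ => 0) ∧
    ∀ R : ℝ, 0 < R →
      (ThermoQVI.exampleData α₁ α₂).M R =
        1 / 2 * R + 10 * (1 + π) / (3 * π * α₁) * R ^ 2 ∧
      (ThermoQVI.exampleData α₁ α₂).contractionFactor ((ThermoQVI.exampleData α₁ α₂).M R) =
        50 * α₂ / (3 * α₁) * (R + 20 * (1 + π) / (3 * π * α₁) * R ^ 2) ∧
      Tendsto (ThermoQVI.exampleData α₁ α₂).contractionFactor
        (𝓝[>] ((ThermoQVI.exampleData α₁ α₂).M R))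
        (𝓝 (50 * α₂ / (3 * α₁) * (R + 20 * (1 + π) / (3 * π * α₁) * R ^ 2))) ∧
      (50 * α₂ / (3 * α₁) * (R + 20 * (1 + π) / (3 * π * α₁) * R ^ 2) ∈ Ico (0 : ℝ) 1 ↔
        R < 3 * α₁ / (10 * (1 + π)) *
          (√(((5 * α₂ + 8) * π ^ 2 + 8 * π) / (80 * α₂)) - π / 4)) := by
  have hα₂' : 0 < α₂ := one_pos.trans_le hα₂
  refine ⟨ThermoQVI.exampleData_isSolution_zero hα₁,
    ThermoQVI.exampleData_isSolution_sin hα₁ hα₂,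
    ThermoQVI.const_mul_sin_not_ae_eq_zero hα₁, fun R hR => ?_⟩
  have hM := ThermoQVI.exampleData_M (α₂ := α₂) hα₁ hR
  have hMpos : 0 < (ThermoQVI.exampleData α₁ α₂).M R := by
    rw [hM]
    positivity
  have hcf : 100 * α₂ / (3 * α₁) * (ThermoQVI.exampleData α₁ α₂).M R =
      50 * α₂ / (3 * α₁) * (R + 20 * (1 + π) / (3 * π * α₁) * R ^ 2) := by
    rw [hM]
    ring
  refine ⟨hM, ?_, ?_, ThermoQVI.contraction_radius_iff hα₁ hα₂' hR⟩
  · rw [ThermoQVI.exampleData_contractionFactor hα₁ hα₂' hMpos, hcf]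
  · rw [← hcf]
    -- The linear formula needs `t > 0`, which holds to the right of `M R > 0`.
    refine Tendsto.congr' ?_ (((continuous_const_mul (100 * α₂ / (3 * α₁))).tendsto _).mono_left
      nhdsWithin_le_nhds)
    filter_upwards [self_mem_nhdsWithin] with t ht
    exact (ThermoQVI.exampleData_contractionFactor hα₁ hα₂' (hMpos.trans ht)).symm
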